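/- **Conventions.** $\log$ is the natural logarithm, $\mathsf{logs}(x_1,\dots,x_n):=\sum_{i=1}^n\log(e+x_i)$, $\mathcal B^d$ is the closed Euclidean unit ball of $\mathbb R^d$, and $\|v\|_A:=\sqrt{v^\top A v}$. Let $$\psi(y)=\begin{cases}\log(1+y+y^2/2), & y\ge 0,\\ -\log(1-y+y^2/2), & y<0.\end{cases}$$ For $T\ge 1$, reals $X_1,\dots,X_T$ and $\alpha>0$, the *Catoni estimate* of $(X_t)_{t=1}^T$ with parameter $\alpha$ is the unique root $z$ of $z\mapsto\sum_{t=1}^T\psi(\alpha(X_t-z))$. **Setting.** Let $(\mathcal F_t)_{t\ge0}$ be a filtration on a probability space, $T,d\in\mathbb N$, $\theta_\star\in\mathbb R^d$, $\sigma_{\min}>0$ and $\beta_\eta\ge0$. For $t=1,\dots,T$ let $\phi_t\in\mathbb R^d$ be $\mathcal F_{t-1}$-measurable random vectors, $y_t$ be $\mathcal F_t$-measurable random scalars, $\sigma_t^2$ be $\mathcal F_{t-1}$-measurable random scalars and $\eta_t$ be random scalars such that, almost surely, $$\|\phi_t\|_2\le1,\quad y_t=\langle\phi_t,\theta_\star\rangle+\eta_t,\quad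 \mathbb E[\eta_t\mid\mathcal F_{t-1}]=0,\quad |\eta_t|\le\beta_\eta,\quad \mathbb E[y_t^2\mid\mathcal F_{t-1}]\le\sigma_t^2,\quad \sigma_t^2\ge\sigma_{\min}^2 .$$ (In particular $\mathbb E[y_t\mid\mathcal F_{t-1}]=\langle\phi_t,\theta_\star\rangle$.) For $\lambda>0$ put $$\Sigma_T=\sum_{t=1}^T\sigma_t^{-2}\phi_t\phi_t^\top,\qquad \Lambda_T=\lambda I+\Sigma_T .$$ **Corollary (Self-Normalized Heteroscedastic Catoni Estimation).** There is a universal constant $c>0$ such that the following holds in every such setting and for all $\lambda>0$, $\alpha_{\max}>0$ and $\delta\in(0,1)$. Let $$d_T:=c\cdot d\cdot\mathsf{logs}\left(T,\alpha_{\max}^2,\lambda^{-1},\sigma_{\min}^{-2},\beta_\eta,\|\theta_\star\|_2\right),$$ and for $v\in\mathbb R^d$ let $\mathsf{cat}[T\Lambda_T^{-1}v]$ be the Catoni estimate of $(X_t)_{t=1}^T$ with parameter $\alpha$, where $$X_t=\frac{T\,v^\top\Lambda_T^{-1}\phi_t\,y_t}{\sigma_t^2},\qquad \alpha=\min\left\{\sqrt{\|T\Lambda_T^{-1}v\|_{\Sigma_T}^{-2}\,\bigl(d_T+\log\tfrac1\delta\bigr)},\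 \alpha_{\max}\right\},$$ with $\alpha=\alpha_{\max}$ if $\|T\Lambda_T^{-1}v\|_{\Sigma_T}=0$. If $T\ge5\left(\log\frac1\delta+d_T\right)$, then with probability at least $1-\delta$, simultaneously for all $v\in\mathcal B^d$, $$\left|\mathsf{cat}[T\Lambda_T^{-1}v]-v^\top\theta_\star\right|\le5\|v\|_{\Lambda_T^{-1}}\left(\sqrt{\log\tfrac1\delta+d_T}+\sqrt\lambda\,\|\theta_\star\|_2\right)+\frac{3\left(\log\frac1\delta+d_T\right)}{\alpha_{\max}T}.$$ -/

import Mathlib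

open MeasureTheory ProbabilityTheory
open scoped Matrix

/-- `logs(x₁,…,xₙ) = ∑ᵢ log (e + xᵢ)`. -/
noncomputable def logs (xs : List ℝ) : ℝ :=
  (xs.map fun x => Real.log (Real.exp 1 + x)).sum

/-- Catoni's influence function. -/
noncomputable def catoniPsi (y : ℝ) : ℝ :=
  if 0 ≤ y then Real.log (1 + y + y ^ 2 / 2) else -Real.log (1 - y + y ^ 2 / 2)

/-- `f(z; X₁,…,X_T, α) = ∑_{t=1}^T ψ(α (X_t - z))`. -/
noncomputable def catoniFun (T : ℕ) (X : ℕ → ℝ) (α z : ℝ) : ℝ :=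
  ∑ t ∈ Finset.Icc 1 T, catoniPsi (α * (X t - z))

open Classical in
/-- The Catoni estimate of `X₁,…,X_T` with parameter `α`: the root of `f(·; X₁,…,X_T, α)`.
For `T ≥ 1` and `α > 0` there is exactly one root, see `existsUnique_catoniFun_eq_zero`;
the value `0` is used when there is no root. -/
noncomputable def catoni (T : ℕ) (X : ℕ → ℝ) (α : ℝ) : ℝ :=
  if h : ∃ z, catoniFun T X α z = 0 then h.choose else 0

theorem catoniPsi_neg (y : ℝ) : catoniPsi (-y) = -catoniPsi y := by
  unfold catoniPsi
  rcases lt_trichotomy y 0 with h | h | h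
  · rw [if_pos (by linarith), if_neg (by linarith)]; ring_nf
  · subst h; simp
  · rw [if_neg (by linarith), if_pos h.le]; ring_nf

theorem catoniPsi_pos {y : ℝ} (hy : 0 < y) : 0 < catoniPsi y := by
  unfold catoniPsi
  rw [if_pos hy.le]
  exact Real.log_pos (by nlinarith)

theorem catoniPsi_nonneg {y : ℝ} (hy : 0 ≤ y) : 0 ≤ catoniPsi y := by
  rcases hy.eq_or_lt with h | h
  · subst h; simp [catoniPsi]
  · exact (catoniPsi_pos h).le

theorem catoniPsi_strictMono : StrictMono catoniPsi := by
  have key : ∀ a b : ℝ, 0 ≤ a → a < b → catoniPsi a < catoniPsi b := by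
    intro a b ha hab
    unfold catoniPsi
    rw [if_pos ha, if_pos (ha.trans hab.le)]
    exact Real.log_lt_log (by positivity) (by nlinarith)
  intro a b hab
  rcases le_or_gt 0 a with ha | ha
  · exact key a b ha hab
  · rcases le_or_gt b 0 with hb | hb
    · have := key (-b) (-a) (by linarith) (by linarith)
      rw [catoniPsi_neg, catoniPsi_neg] at this
      linarith
    · have h1 := catoniPsi_pos hb
      have h2 := catoniPsi_pos (y := -a) (by linarith)
      rw [catoniPsi_neg] at h2
      linarith

theorem catoniPsi_continuous : Continuous catoniPsi := by
  unfold catoniPsi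
  refine Continuous.if_le ?_ ?_ continuous_const continuous_id ?_
  · refine Continuous.log (by fun_prop) fun y => ?_
    nlinarith [sq_nonneg (1 + y)]
  · refine (Continuous.log (by fun_prop) fun y => ?_).neg
    nlinarith [sq_nonneg (1 - y)]
  · intro y hy
    subst hy
    simp

theorem existsUnique_catoniFun_eq_zero {T : ℕ} (hT : 1 ≤ T) (X : ℕ → ℝ) {α : ℝ} (hα : 0 < α) :
    ∃! z, catoniFun T X α z = 0 := by
  have hne : (Finset.Icc 1 T).Nonempty := ⟨1, by simp [hT]⟩
  have hanti : StrictAnti (catoniFun T X α) := by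
    intro a b hab
    refine Finset.sum_lt_sum_of_nonempty hne fun t _ => catoniPsi_strictMono ?_
    nlinarith
  have hcont : Continuous (catoniFun T X α) := by
    unfold catoniFun
    exact continuous_finsetSum _ fun t _ => catoniPsi_continuous.comp (by fun_prop)
  set B : ℝ := ∑ t ∈ Finset.Icc 1 T, |X t| with hB
  have hXB : ∀ t ∈ Finset.Icc 1 T, |X t| ≤ B := fun t ht =>
    Finset.single_le_sum (f := fun t => |X t|) (fun i _ => abs_nonneg _) ht
  have h1 : 0 ≤ catoniFun T X α (-B) := Finset.sum_nonneg fun t ht => catoniPsi_nonneg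
    (mul_nonneg hα.le (by have := neg_abs_le (X t); have := hXB t ht; linarith))
  have h2 : catoniFun T X α B ≤ 0 := Finset.sum_nonpos fun t ht => by
    have h := catoniPsi_nonneg (y := -(α * (X t - B))) (by
      have := le_abs_self (X t); have := hXB t ht; nlinarith)
    rw [catoniPsi_neg] at h
    linarith
  obtain ⟨z, hz⟩ := mem_range_of_exists_le_of_exists_ge hcont ⟨B, h2⟩ ⟨-B, h1⟩
  exact ⟨z, hz, fun z' hz' => hanti.injective (hz'.trans hz.symm)⟩

theorem catoni_eq_iff {T : ℕ} (hT : 1 ≤ T) (X : ℕ → ℝ) {α : ℝ} (hα : 0 < α) (z : ℝ) :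
    catoni T X α = z ↔ catoniFun T X α z = 0 := by
  have hu := existsUnique_catoniFun_eq_zero hT X hα
  have hroot : catoniFun T X α (catoni T X α) = 0 := by
    unfold catoni
    rw [dif_pos hu.exists]
    exact hu.exists.choose_spec
  exact ⟨fun h => h ▸ hroot, fun h => hu.unique hroot h⟩

/-- The (semi)norm `‖v‖_A = √(vᵀ A v)`. -/
noncomputable def matNorm {d : ℕ} (A : Matrix (Fin d) (Fin d) ℝ) (v : Fin d → ℝ) : ℝ :=
  √(v ⬝ᵥ A *ᵥ v)

/-- `Σ_T = ∑_{t=1}^T σ_t⁻² φ_t φ_tᵀ`. -/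
noncomputable def covSigma {d : ℕ} (T : ℕ) (φ : ℕ → EuclideanSpace ℝ (Fin d)) (σ : ℕ → ℝ) :
    Matrix (Fin d) (Fin d) ℝ :=
  ∑ t ∈ Finset.Icc 1 T, (σ t ^ 2)⁻¹ • Matrix.vecMulVec (φ t).ofLp (φ t).ofLp

/-- `Λ_T = lam I + Σ_T`. -/
noncomputable def covLambda {d : ℕ} (T : ℕ) (lam : ℝ) (φ : ℕ → EuclideanSpace ℝ (Fin d))
    (σ : ℕ → ℝ) : Matrix (Fin d) (Fin d) ℝ :=
  lam • (1 : Matrix (Fin d) (Fin d) ℝ) + covSigma T φ σ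

/-- The effective dimension `d_T`. -/
noncomputable def effDim (c : ℝ) (d T : ℕ) (αmax lam σmin βη θnorm : ℝ) : ℝ :=
  c * d * logs [(T : ℝ), αmax ^ 2, lam⁻¹, (σmin ^ 2)⁻¹, βη, θnorm]

/-- The parameter `min {√(‖T Λ_T⁻¹ v‖_{Σ_T}⁻² L), αmax}`, which is read as `αmax` when
`‖T Λ_T⁻¹ v‖_{Σ_T} = 0`. -/
noncomputable def catoniParam {d : ℕ} (T : ℕ) (lam αmax L : ℝ)
    (φ : ℕ → EuclideanSpace ℝ (Fin d)) (σ : ℕ → ℝ) (v : EuclideanSpace ℝ (Fin d)) : ℝ :=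
  let N := matNorm (covSigma T φ σ) ((T : ℝ) • ((covLambda T lam φ σ)⁻¹ *ᵥ v.ofLp))
  if N = 0 then αmax else min (√((N ^ 2)⁻¹ * L)) αmax

/-- `cat[T Λ_T⁻¹ v]`: the Catoni estimate of `X_t = T vᵀ Λ_T⁻¹ φ_t y_t / σ_t²`, `t = 1,…,T`, with
the data-dependent parameter `catoniParam`. -/
noncomputable def catoniDirectional {d : ℕ} (T : ℕ) (lam αmax L : ℝ)
    (φ : ℕ → EuclideanSpace ℝ (Fin d)) (y σ : ℕ → ℝ) (v : EuclideanSpace ℝ (Fin d)) : ℝ :=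
  catoni T
    (fun t => (T : ℝ) * (v.ofLp ⬝ᵥ (covLambda T lam φ σ)⁻¹ *ᵥ (φ t).ofLp) * y t / σ t ^ 2)
    (catoniParam T lam αmax L φ σ v)

/-- Heteroscedastic martingale linear regression over `t = 1,…,T` with parameter `θ`, almost surely
bounded noise and variance proxies bounded below.  As `φ t` and the noise `η t` are almost surely
bounded, `η t`, `y t` and `y t ^ 2` are integrable, so that every conditional expectation below is a
genuine one; `E[y t | ℱ (t-1)] = ⟪φ t, θ⟫` and `E[η t ^ 2 | ℱ (t-1)] < ∞` are consequences. -/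
structure BoundedHeteroscedasticRegression {Ω : Type*} [mΩ : MeasurableSpace Ω] (μ : Measure Ω)
    (ℱ : Filtration ℕ mΩ) {d : ℕ} (T : ℕ) (φ : ℕ → Ω → EuclideanSpace ℝ (Fin d))
    (y η σ : ℕ → Ω → ℝ) (θ : EuclideanSpace ℝ (Fin d)) (σmin βη : ℝ) : Prop where
  measurable_feature : ∀ t ∈ Finset.Icc 1 T, Measurable[ℱ (t - 1)] (φ t)
  feature_le_one : ∀ t ∈ Finset.Icc 1 T, ∀ᵐ ω ∂μ, ‖φ t ω‖ ≤ 1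
  measurable_target : ∀ t ∈ Finset.Icc 1 T, Measurable[ℱ t] (y t)
  target_eq : ∀ t ∈ Finset.Icc 1 T, ∀ᵐ ω ∂μ, y t ω = inner ℝ (φ t ω) θ + η t ω
  noise_mean : ∀ t ∈ Finset.Icc 1 T, μ[η t | ℱ (t - 1)] =ᵐ[μ] 0
  noise_bound : ∀ t ∈ Finset.Icc 1 T, ∀ᵐ ω ∂μ, |η t ω| ≤ βη
  measurable_variance : ∀ t ∈ Finset.Icc 1 T, Measurable[ℱ (t - 1)] (fun ω => σ t ω ^ 2)
  second_moment_le : ∀ t ∈ Finset.Icc 1 T,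
    μ[fun ω => y t ω ^ 2 | ℱ (t - 1)] ≤ᵐ[μ] fun ω => σ t ω ^ 2
  variance_ge : ∀ t ∈ Finset.Icc 1 T, ∀ᵐ ω ∂μ, σmin ^ 2 ≤ σ t ω ^ 2

/-! Write w = Λ_T⁻¹v and let M be the sum of σ_t⁻²⟨w,φ_t⟩⟨φ_t,θ⟩. Since Λ_T w = v, ⟨v,θ⟩ = M +
lam⟨w,θ⟩. The last term is the ridge bias, at most √lam ‖v‖_{Λ_T⁻¹}‖θ‖. It remains to show that the
Catoni root is close to M.

For a nonrandom pair (p, b), put r_t = σ_t⁻². The bound exp ψ(x) ≤ 1 + x + x²/2 involves only the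
first two conditional moments of y_t. Subtracting a predictable quadratic compensator from ψ(⟨p,φ_t⟩
r_t y_t - b) therefore leaves an exponential of conditional mean at most 1. The product over t has
mean at most 1, and Markov's inequality gives `catoniExcess` an exponential tail with no dependence
on the size of the noise (`measure_le_catoniExcess_le`).

The pair needed is p = αTw, b = αM + 3L/T. It depends on all the data, so no martingale argument
applies to it directly. However, it lies in a ball of radius polynomial in the parameters inside
`logs`, and the excess is Lipschitz there because ψ is 1-Lipschitz. A union bound over a grid in d +
1 dimensions costs d log Q with log Q = `logs`, which is d_T (`exists_finset_net`,
`catoniExcess_le_add_one`). The noise bound enters only here, through the Lipschitz constant.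

On the resulting event the rest is deterministic: small excess forces the Catoni function to be
negative just above M (`catoni_le_of_sum_le`), oddness of ψ gives the other side, and the choice of
α turns the width 3L/(αT) into the stated bound. -/

/-! ### Catoni's influence function. -/

/-- For x < 0 this is (1 - x + x²/2)(1 + x + x²/2) = 1 + x⁴/4 ≥ 1. -/
theorem exp_catoniPsi_le (x : ℝ) : Real.exp (catoniPsi x) ≤ 1 + x + x ^ 2 / 2 := by
  unfold catoniPsi
  split_ifs with h
  · rw [Real.exp_log (by positivity)]
  · have h1 : 0 < 1 - x + x ^ 2 / 2 := by nlinarith [sq_nonneg (1 - x)]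
    rw [Real.exp_neg, Real.exp_log h1, inv_le_iff_one_le_mul₀ h1]
    nlinarith [sq_nonneg (x ^ 2)]

/-- On the positive side, with q(a) = 1 + a + a²/2, one has q(a + k) ≤ q(a) q(k) ≤ q(a) eᵏ. Oddness
gives the negative side, and an interval across 0 is split there. -/
theorem catoniPsi_add_le (x : ℝ) {h : ℝ} (hh : 0 ≤ h) : catoniPsi (x + h) ≤ catoniPsi x + h := by
  have key : ∀ a k : ℝ, 0 ≤ a → 0 ≤ k → catoniPsi (a + k) ≤ catoniPsi a + k := by
    intro a k ha hk
    unfold catoniPsi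
    rw [if_pos ha, if_pos (add_nonneg ha hk), Real.log_le_iff_le_exp (by positivity),
      Real.exp_add, Real.exp_log (by positivity)]
    calc 1 + (a + k) + (a + k) ^ 2 / 2 ≤ (1 + a + a ^ 2 / 2) * (1 + k) + k ^ 2 / 2 := by
          nlinarith [mul_nonneg (sq_nonneg a) hk]
      _ ≤ (1 + a + a ^ 2 / 2) * (1 + k + k ^ 2 / 2) := by
          nlinarith [mul_nonneg ha (sq_nonneg k), mul_nonneg (sq_nonneg a) (sq_nonneg k)]
      _ ≤ _ := mul_le_mul_of_nonneg_left (Real.quadratic_le_exp_of_nonneg hk) (by positivity)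
  have key' : ∀ a k : ℝ, a + k ≤ 0 → 0 ≤ k → catoniPsi (a + k) ≤ catoniPsi a + k := by
    intro a k ha hk
    have := key (-(a + k)) k (by linarith) hk
    rw [show -(a + k) + k = -a by ring, catoniPsi_neg, catoniPsi_neg] at this
    linarith
  rcases le_total 0 x with hx | hx
  · exact key x h hx hh
  rcases le_total (x + h) 0 with hxh | hxh
  · exact key' x h hxh hh
  have h1 := key 0 (x + h) le_rfl hxh
  have h2 := key' x (-x) (by linarith) (by linarith)
  have h3 : catoniPsi 0 = 0 := by simp [catoniPsi]
  rw [zero_add, h3] at h1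
  rw [add_neg_cancel, h3] at h2
  linarith

theorem abs_catoniPsi_sub_le (x y : ℝ) : |catoniPsi x - catoniPsi y| ≤ |x - y| := by
  wlog h : y ≤ x generalizing x y
  · rw [abs_sub_comm, abs_sub_comm x]
    exact this y x (le_of_not_ge h)
  have h1 := catoniPsi_add_le y (sub_nonneg.2 h)
  rw [add_sub_cancel] at h1
  have h2 := catoniPsi_strictMono.monotone h
  rw [abs_of_nonneg (sub_nonneg.2 h2), abs_of_nonneg (sub_nonneg.2 h)]
  linarith

theorem catoniFun_strictAnti {T : ℕ} (hT : 1 ≤ T) (X : ℕ → ℝ) {α : ℝ} (hα : 0 < α) :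
    StrictAnti (catoniFun T X α) := by
  intro a b hab
  refine Finset.sum_lt_sum_of_nonempty ⟨1, by simp [hT]⟩ fun t _ => catoniPsi_strictMono ?_
  nlinarith

theorem catoni_neg {T : ℕ} (hT : 1 ≤ T) (X : ℕ → ℝ) {α : ℝ} (hα : 0 < α) :
    catoni T (fun t => -X t) α = -catoni T X α := by
  rw [catoni_eq_iff hT _ hα]
  have h : catoniFun T X α (catoni T X α) = 0 := (catoni_eq_iff hT X hα _).1 rfl
  have h2 : catoniFun T (fun t => -X t) α (-catoni T X α) = -catoniFun T X α (catoni T X α) := by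
    unfold catoniFun
    rw [← Finset.sum_neg_distrib]
    refine Finset.sum_congr rfl fun t _ => ?_
    rw [← catoniPsi_neg]
    congr 1
    ring
  rw [h2, h, neg_zero]

/-! ### Compensated increments and their effect on the root. -/

/-- The gap between `ψ (x r y - b)` and the bound on its conditional log-moment that is obtained
when `y` has mean `ν` and second moment at most `r⁻¹`. -/
noncomputable def catoniIncrement (x r y ν b : ℝ) : ℝ :=
  catoniPsi (x * r * y - b) - (x * r * ν - b + (x ^ 2 * r - 2 * b * (x * r * ν) + b ^ 2) / 2)

/-- The sum of the gaps `catoniIncrement` along the direction `p`. -/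
noncomputable def catoniExcess {d : ℕ} (T : ℕ) (φ : ℕ → EuclideanSpace ℝ (Fin d)) (y σ : ℕ → ℝ)
    (θ p : EuclideanSpace ℝ (Fin d)) (b : ℝ) : ℝ :=
  ∑ t ∈ Finset.Icc 1 T,
    catoniIncrement (inner ℝ p (φ t)) (σ t ^ 2)⁻¹ (y t) (inner ℝ (φ t) θ) b

/-- Lipschitz bound in the pair (x, b), used to pass from the net to arbitrary data-dependent pairs.
Only its polynomial size matters, since the mesh enters d_T through a logarithm. -/
theorem abs_catoniIncrement_sub_le {x x' r y ν b b' ε A R C B : ℝ} (hx : |x| ≤ A) (hx' : |x'| ≤ A)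
    (hr0 : 0 ≤ r) (hr : r ≤ R) (hy : |y| ≤ C) (hν : |ν| ≤ C) (hb : |b| ≤ B) (hb' : |b'| ≤ B)
    (hxx : |x - x'| ≤ ε) (hbb : |b - b'| ≤ ε) :
    |catoniIncrement x r y ν b - catoniIncrement x' r y ν b'| ≤
      ε * (2 * (R * C) + 2 + A * R + A * (R * C) + B * (R * C) + B) := by
  have hε : 0 ≤ ε := (abs_nonneg _).trans hxx
  have hA : 0 ≤ A := (abs_nonneg _).trans hx
  have hB : 0 ≤ B := (abs_nonneg _).trans hb
  have hry : |r * y| ≤ R * C := by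
    rw [abs_mul, abs_of_nonneg hr0]; exact mul_le_mul hr hy (abs_nonneg _) (hr0.trans hr)
  have hrν : |r * ν| ≤ R * C := by
    rw [abs_mul, abs_of_nonneg hr0]; exact mul_le_mul hr hν (abs_nonneg _) (hr0.trans hr)
  have hRC : 0 ≤ R * C := (abs_nonneg _).trans hry
  have mulle : ∀ {u v U V : ℝ}, |u| ≤ U → |v| ≤ V → |u * v| ≤ U * V := fun h1 h2 => by
    rw [abs_mul]; exact mul_le_mul h1 h2 (abs_nonneg _) ((abs_nonneg _).trans h1)
  have e1 : |(x - x') * (r * y)| ≤ ε * (R * C) := mulle hxx hry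
  have e2 : |(x - x') * (r * ν)| ≤ ε * (R * C) := mulle hxx hrν
  have e3 : |(x - x') * ((x + x') * r)| ≤ ε * (2 * A * R) := by
    refine mulle hxx (mulle ?_ (by rwa [abs_of_nonneg hr0]))
    exact (abs_add_le _ _).trans (by linarith)
  have e4 : |(b - b') * (x * (r * ν))| ≤ ε * (A * (R * C)) := mulle hbb (mulle hx hrν)
  have e5 : |b' * ((x - x') * (r * ν))| ≤ B * (ε * (R * C)) := mulle hb' (mulle hxx hrν)
  have e6 : |(b - b') * (b + b')| ≤ ε * (2 * B) :=
    mulle hbb ((abs_add_le _ _).trans (by linarith))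
  have e0 := abs_catoniPsi_sub_le (x * r * y - b) (x' * r * y - b')
  have e0' : |x * r * y - b - (x' * r * y - b')| ≤ ε * (R * C) + ε := by
    rw [show x * r * y - b - (x' * r * y - b') = (x - x') * (r * y) - (b - b') by ring]
    exact (abs_sub _ _).trans (add_le_add e1 hbb)
  have e7 := e0.trans e0'
  have hid : catoniIncrement x r y ν b - catoniIncrement x' r y ν b' =
      (catoniPsi (x * r * y - b) - catoniPsi (x' * r * y - b')) - ((x - x') * (r * ν) - (b - b')
        + ((x - x') * ((x + x') * r)) / 2 - (b - b') * (x * (r * ν)) - b' * ((x - x') * (r * ν))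
        + (b - b') * (b + b') / 2) := by
    unfold catoniIncrement; ring
  rw [hid]
  rw [abs_le] at *
  constructor <;> nlinarith

/-- At z = M + 3L/(αT) the compensators sum to -3L + (α²∑s + 9L²/T - T(αM)²)/2. With α²∑s ≤ L and 5L
≤ T this is at most -3L + L/2 + 9L/10 = -1.6L. An excess of at most L thus makes the Catoni function
negative at z, so its root lies below z. The means m_t may vary: only their average M matters. -/
theorem catoni_le_of_sum_le {T : ℕ} (hT : 1 ≤ T) {X m s : ℕ → ℝ} {α L M : ℝ} (hα : 0 < α)
    (hL : 0 < L) (hLT : 5 * L ≤ T) (hM : ∑ t ∈ Finset.Icc 1 T, m t = T * M)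
    (hs : α ^ 2 * ∑ t ∈ Finset.Icc 1 T, s t ≤ L)
    (h : ∑ t ∈ Finset.Icc 1 T, (catoniPsi (α * X t - (α * M + 3 * L / T)) -
      (α * m t - (α * M + 3 * L / T) + (α ^ 2 * s t - 2 * (α * M + 3 * L / T) * (α * m t) +
        (α * M + 3 * L / T) ^ 2) / 2)) ≤ L) :
    catoni T X α ≤ M + 3 * L / (α * T) := by
  have hT0 : (0 : ℝ) < T := by exact_mod_cast hT
  set b := α * M + 3 * L / T with hb
  have hbz : α * (M + 3 * L / (α * T)) = b := by rw [hb]; field_simp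
  by_contra! hlt
  have h1 := catoniFun_strictAnti hT X hα hlt
  rw [(catoni_eq_iff hT X hα _).1 rfl] at h1
  have h2 : catoniFun T X α (M + 3 * L / (α * T)) =
      ∑ t ∈ Finset.Icc 1 T, catoniPsi (α * X t - b) := by
    unfold catoniFun
    simp only [mul_sub, hbz]
  have h3 : ∑ t ∈ Finset.Icc 1 T, (α * m t - b + (α ^ 2 * s t - 2 * b * (α * m t) + b ^ 2) / 2) =
      α * (T * M) - T * b + (α ^ 2 * ∑ t ∈ Finset.Icc 1 T, s t - 2 * b * (α * (T * M)) +
        T * b ^ 2) / 2 := by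
    rw [← hM]
    simp only [Finset.sum_add_distrib, Finset.sum_sub_distrib, ← Finset.sum_div, ← Finset.mul_sum,
      Finset.sum_const, Nat.card_Icc, add_tsub_cancel_right, nsmul_eq_mul]
  rw [Finset.sum_sub_distrib, h3, ← h2] at h
  have h4 : T * (3 * L / T) = 3 * L := by field_simp
  have h5 : T * (3 * L / T) ^ 2 ≤ 9 / 5 * L := by
    rw [show T * (3 * L / T) ^ 2 = 9 * L * (L / T) by field_simp; ring]
    have : L / T ≤ 1 / 5 := by rw [div_le_iff₀ hT0]; linarith
    nlinarith
  have h6 : 0 ≤ T * (α * M) ^ 2 := by positivity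
  have h7 : α * (T * M) - T * b + (α ^ 2 * ∑ t ∈ Finset.Icc 1 T, s t - 2 * b * (α * (T * M)) +
        T * b ^ 2) / 2 = - (T * (3 * L / T)) + (α ^ 2 * ∑ t ∈ Finset.Icc 1 T, s t
        + T * (3 * L / T) ^ 2 - T * (α * M) ^ 2) / 2 := by rw [hb]; ring
  rw [h7] at h
  linarith

/-! ### Exponential supermartingale. -/

theorem integrable_prod_and_integral_le_one {Ω : Type*} {mΩ : MeasurableSpace Ω} {μ : Measure Ω}
    [IsProbabilityMeasure μ] {ℱ : Filtration ℕ mΩ} {g : ℕ → Ω → ℝ} (T : ℕ)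
    (hmeas : ∀ t ∈ Finset.Icc 1 T, StronglyMeasurable[ℱ t] (g t))
    (hpos : ∀ t ∈ Finset.Icc 1 T, ∀ ω, 0 ≤ g t ω)
    (hbdd : ∀ t ∈ Finset.Icc 1 T, ∃ C, ∀ᵐ ω ∂μ, g t ω ≤ C)
    (hle : ∀ t ∈ Finset.Icc 1 T, μ[g t | ℱ (t - 1)] ≤ᵐ[μ] 1) :
    StronglyMeasurable[ℱ T] (fun ω => ∏ t ∈ Finset.Icc 1 T, g t ω) ∧
    Integrable (fun ω => ∏ t ∈ Finset.Icc 1 T, g t ω) μ ∧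
      ∫ ω, ∏ t ∈ Finset.Icc 1 T, g t ω ∂μ ≤ 1 := by
  induction T with
  | zero =>
    simp only [Finset.Icc_eq_empty_of_lt Nat.zero_lt_one, Finset.prod_empty]
    exact ⟨stronglyMeasurable_const, integrable_const _, by simp⟩
  | succ n ih =>
    have hsub : ∀ t ∈ Finset.Icc 1 n, t ∈ Finset.Icc 1 (n + 1) := fun t ht => by
      simp only [Finset.mem_Icc] at ht ⊢; omega
    obtain ⟨h1, h2, h3⟩ := ih (fun t ht => hmeas t (hsub t ht)) (fun t ht => hpos t (hsub t ht))
      (fun t ht => hbdd t (hsub t ht)) (fun t ht => hle t (hsub t ht))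
    have hn : n + 1 ∈ Finset.Icc 1 (n + 1) := by simp
    simp only [Finset.prod_Icc_succ_top (Nat.le_add_left 1 n)]
    set Z : Ω → ℝ := fun ω => ∏ t ∈ Finset.Icc 1 n, g t ω with hZ
    have hZ0 : ∀ ω, 0 ≤ Z ω := fun ω => Finset.prod_nonneg fun t ht => hpos t (hsub t ht) ω
    obtain ⟨C, hC⟩ := hbdd _ hn
    have hgC : ∀ᵐ ω ∂μ, ‖g (n + 1) ω‖ ≤ C := by
      filter_upwards [hC] with ω hω
      rwa [Real.norm_of_nonneg (hpos _ hn ω)]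
    have hgm : AEStronglyMeasurable (g (n + 1)) μ :=
      ((hmeas _ hn).mono (ℱ.le _)).aestronglyMeasurable
    have hgi : Integrable (g (n + 1)) μ := Integrable.of_bound hgm C hgC
    have hint : Integrable (fun ω => Z ω * g (n + 1) ω) μ := h2.mul_bdd hgm hgC
    refine ⟨(h1.mono (ℱ.mono n.le_succ)).mul (hmeas _ hn), hint, ?_⟩
    have hpull := condExp_mul_of_stronglyMeasurable_left (μ := μ) h1 hint hgi
    have hcond := hle _ hn
    rw [add_tsub_cancel_right] at hcond
    calc ∫ ω, Z ω * g (n + 1) ω ∂μ = ∫ ω, (μ[Z * g (n + 1) | ℱ n]) ω ∂μ :=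
          (integral_condExp (ℱ.le n)).symm
      _ ≤ ∫ ω, Z ω ∂μ := by
          refine integral_mono_ae integrable_condExp h2 ?_
          filter_upwards [hpull, hcond] with ω e1 e2
          rw [e1, Pi.mul_apply]
          exact mul_le_of_le_one_right (hZ0 ω) e2
      _ ≤ 1 := h3

section Increment

variable {Ω : Type*} {m mΩ : MeasurableSpace Ω} {μ : Measure Ω} {x r y ν : Ω → ℝ} {A R C : ℝ}

theorem exp_catoniIncrement_le {x r y ν b A R C : ℝ} (hx : |x| ≤ A) (hr0 : 0 ≤ r) (hr : r ≤ R)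
    (hν : |ν| ≤ C) :
    let w := Real.exp (-(x * r * ν - b + (x ^ 2 * r - 2 * b * (x * r * ν) + b ^ 2) / 2))
    w ≤ Real.exp (A * R * C + |b| + |b| * (A * R * C)) ∧
      Real.exp (catoniIncrement x r y ν b) ≤
        w * (1 - b + b ^ 2 / 2) + w * (x * r * (1 - b)) * y + w * (x ^ 2 * r ^ 2 / 2) * y ^ 2 := by
  intro w
  have hA : 0 ≤ A := (abs_nonneg _).trans hx
  have hR := hr0.trans hr
  constructor
  · refine Real.exp_le_exp.2 ?_
    have h1 : |x * r * ν| ≤ A * R * C := by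
      rw [abs_mul, abs_mul, abs_of_nonneg hr0]
      exact mul_le_mul (mul_le_mul hx hr hr0 hA) hν (abs_nonneg _) (mul_nonneg hA hR)
    have h2 : |b * (x * r * ν)| ≤ |b| * (A * R * C) := by
      rw [abs_mul]; exact mul_le_mul_of_nonneg_left h1 (abs_nonneg b)
    have h3 : 0 ≤ x ^ 2 * r := by positivity
    have h4 := neg_abs_le (x * r * ν)
    have h5 := le_abs_self (b * (x * r * ν))
    have h6 := le_abs_self b
    nlinarith [sq_nonneg b]
  · have h : catoniIncrement x r y ν b = catoniPsi (x * r * y - b) +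
        -(x * r * ν - b + (x ^ 2 * r - 2 * b * (x * r * ν) + b ^ 2) / 2) := by
      unfold catoniIncrement; ring
    rw [h, Real.exp_add]
    refine (mul_le_mul_of_nonneg_right (exp_catoniPsi_le _) (Real.exp_pos _).le).trans
      (le_of_eq ?_)
    change _ * w = _
    ring

/-- The exponential is dominated by a quadratic polynomial in y with `m`-measurable coefficients, so
conditioning replaces y by ν and y² by at most 1/r. If a is the compensator, the result is at most
e⁻ᵃ(1 + a) ≤ 1. -/
theorem condExp_exp_catoniIncrement_le_one [IsProbabilityMeasure μ] (hm : m ≤ mΩ)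
    (hxm : Measurable[m] x) (hrm : Measurable[m] r) (hνm : Measurable[m] ν) (hym : Measurable y)
    (hx : ∀ᵐ ω ∂μ, |x ω| ≤ A) (hr0 : ∀ᵐ ω ∂μ, 0 < r ω) (hr : ∀ᵐ ω ∂μ, r ω ≤ R)
    (hy : ∀ᵐ ω ∂μ, |y ω| ≤ C) (hν : ∀ᵐ ω ∂μ, |ν ω| ≤ C) (hmean : μ[y | m] =ᵐ[μ] ν)
    (hsq : μ[fun ω => y ω ^ 2 | m] ≤ᵐ[μ] fun ω => (r ω)⁻¹) (b : ℝ) :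
    (∃ D, ∀ᵐ ω ∂μ, Real.exp (catoniIncrement (x ω) (r ω) (y ω) (ν ω) b) ≤ D) ∧
      μ[fun ω => Real.exp (catoniIncrement (x ω) (r ω) (y ω) (ν ω) b) | m] ≤ᵐ[μ] 1 := by
  set w : Ω → ℝ := fun ω => Real.exp (-(x ω * r ω * ν ω - b +
    (x ω ^ 2 * r ω - 2 * b * (x ω * r ω * ν ω) + b ^ 2) / 2)) with hw
  set W := Real.exp (A * R * C + |b| + |b| * (A * R * C)) with hW
  have hW0 : 0 < W := Real.exp_pos _
  have hw0 : ∀ ω, 0 < w ω := fun ω => Real.exp_pos _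
  have hwm : Measurable[m] w := Real.measurable_exp.comp (by fun_prop)
  set f₀ : Ω → ℝ := fun ω => w ω * (1 - b + b ^ 2 / 2) with hf₀
  set f₁ : Ω → ℝ := fun ω => w ω * (x ω * r ω * (1 - b)) with hf₁
  set f₂ : Ω → ℝ := fun ω => w ω * (x ω ^ 2 * r ω ^ 2 / 2) with hf₂
  have hf₀m : Measurable[m] f₀ := by fun_prop
  have hf₁m : Measurable[m] f₁ := by fun_prop
  have hf₂m : Measurable[m] f₂ := by fun_prop
  have hB₀ : ∀ᵐ ω ∂μ, ‖f₀ ω‖ ≤ W * |1 - b + b ^ 2 / 2| := by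
    filter_upwards [hx, hr0, hr, hν] with ω h1 h2 h3 h4
    rw [Real.norm_eq_abs, hf₀, abs_mul, abs_of_pos (hw0 ω)]
    exact mul_le_mul_of_nonneg_right (exp_catoniIncrement_le (y := 0) h1 h2.le h3 h4).1
      (abs_nonneg _)
  have hB₁ : ∀ᵐ ω ∂μ, ‖f₁ ω‖ ≤ W * (A * R * |1 - b|) := by
    filter_upwards [hx, hr0, hr, hν] with ω h1 h2 h3 h4
    rw [Real.norm_eq_abs, hf₁, abs_mul, abs_of_pos (hw0 ω), abs_mul, abs_mul, abs_of_pos h2]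
    refine mul_le_mul (exp_catoniIncrement_le (y := 0) h1 h2.le h3 h4).1 ?_ (by positivity) hW0.le
    exact mul_le_mul_of_nonneg_right (mul_le_mul h1 h3 h2.le ((abs_nonneg _).trans h1))
      (abs_nonneg _)
  have hB₂ : ∀ᵐ ω ∂μ, ‖f₂ ω‖ ≤ W * (A ^ 2 * R ^ 2 / 2) := by
    filter_upwards [hx, hr0, hr, hν] with ω h1 h2 h3 h4
    rw [Real.norm_of_nonneg (by positivity [hw0 ω])]
    refine mul_le_mul (exp_catoniIncrement_le (y := 0) h1 h2.le h3 h4).1 ?_ (by positivity) hW0.le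
    rw [← sq_abs (x ω)]
    gcongr
  have hyi : Integrable y μ := Integrable.of_bound hym.aestronglyMeasurable C hy
  have hyi2 : Integrable (fun ω => y ω ^ 2) μ := by
    refine Integrable.of_bound (hym.pow_const 2).aestronglyMeasurable (C ^ 2) ?_
    filter_upwards [hy] with ω h
    rw [Real.norm_of_nonneg (sq_nonneg _), ← sq_abs]
    gcongr
  have hi₀ : Integrable f₀ μ := Integrable.of_bound (hf₀m.mono hm le_rfl).aestronglyMeasurable _ hB₀
  have hi₁ : Integrable (f₁ * y) μ := hyi.bdd_mul (hf₁m.mono hm le_rfl).aestronglyMeasurable hB₁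
  have hi₂ : Integrable (f₂ * fun ω => y ω ^ 2) μ :=
    hyi2.bdd_mul (hf₂m.mono hm le_rfl).aestronglyMeasurable hB₂
  have hle : ∀ᵐ ω ∂μ, Real.exp (catoniIncrement (x ω) (r ω) (y ω) (ν ω) b) ≤
      (f₀ + f₁ * y + f₂ * fun ω => y ω ^ 2) ω := by
    filter_upwards [hx, hr0, hr, hν] with ω h1 h2 h3 h4
    exact (exp_catoniIncrement_le h1 h2.le h3 h4).2
  have hbd : ∀ᵐ ω ∂μ, Real.exp (catoniIncrement (x ω) (r ω) (y ω) (ν ω) b) ≤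
      W * |1 - b + b ^ 2 / 2| + W * (A * R * |1 - b|) * C + W * (A ^ 2 * R ^ 2 / 2) * C ^ 2 := by
    filter_upwards [hle, hB₀, hB₁, hB₂, hy] with ω h h0 h1 h2 h3
    have h4 : f₁ ω * y ω ≤ W * (A * R * |1 - b|) * C :=
      (le_abs_self _).trans (by
        rw [abs_mul]; exact mul_le_mul h1 h3 (abs_nonneg _) ((norm_nonneg _).trans h1))
    have h5 : f₂ ω * y ω ^ 2 ≤ W * (A ^ 2 * R ^ 2 / 2) * C ^ 2 :=
      (le_abs_self _).trans (by
        rw [abs_mul, abs_pow]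
        exact mul_le_mul h2 (pow_le_pow_left₀ (abs_nonneg _) h3 2) (by positivity)
          ((norm_nonneg _).trans h2))
    have h6 := (le_abs_self (f₀ ω)).trans h0
    exact h.trans (add_le_add (add_le_add h6 h4) h5)
  refine ⟨⟨_, hbd⟩, ?_⟩
  have hmeas : Measurable fun ω => Real.exp (catoniIncrement (x ω) (r ω) (y ω) (ν ω) b) := by
    have hxm' := hxm.mono hm le_rfl; have hrm' := hrm.mono hm le_rfl
    have hνm' := hνm.mono hm le_rfl
    have := catoniPsi_continuous.measurable
    unfold catoniIncrement
    fun_prop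
  have hgi : Integrable (fun ω => Real.exp (catoniIncrement (x ω) (r ω) (y ω) (ν ω) b)) μ := by
    exact Integrable.of_bound hmeas.aestronglyMeasurable _
      (hbd.mono fun ω h => (Real.norm_of_nonneg (Real.exp_pos _).le).trans_le h)
  have hmono := condExp_mono (m := m) hgi ((hi₀.add hi₁).add hi₂) hle
  filter_upwards [hmono, condExp_add (hi₀.add hi₁) hi₂ m, condExp_add hi₀ hi₁ m,
    condExp_mul_of_stronglyMeasurable_left hf₁m.stronglyMeasurable hi₁ hyi,
    condExp_mul_of_stronglyMeasurable_left hf₂m.stronglyMeasurable hi₂ hyi2, hmean, hsq, hr0]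
    with ω e1 e2 e3 e4 e5 e6 e7 e8
  rw [e2, Pi.add_apply, e3, Pi.add_apply, e4, e5, Pi.mul_apply, Pi.mul_apply, e6,
    condExp_of_stronglyMeasurable hm hf₀m.stronglyMeasurable hi₀] at e1
  have hf2 : 0 ≤ f₂ ω := by positivity [hw0 ω]
  have h2 := mul_le_mul_of_nonneg_left e7 hf2
  set a := x ω * r ω * ν ω - b + (x ω ^ 2 * r ω - 2 * b * (x ω * r ω * ν ω) + b ^ 2) / 2 with ha
  -- The compensator was chosen for this identity: the second moment of x r y is at most x²r²·r⁻¹ =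
  -- x²r.
  have h3 : f₀ ω + f₁ ω * ν ω + f₂ ω * (r ω)⁻¹ = w ω * (a + 1) := by
    simp only [hf₀, hf₁, hf₂, ha]
    field_simp
    ring
  have h4 : w ω * (a + 1) ≤ 1 := by
    calc w ω * (a + 1) ≤ w ω * Real.exp a :=
          mul_le_mul_of_nonneg_left (Real.add_one_le_exp a) (hw0 ω).le
      _ = 1 := by simp only [hw, ← Real.exp_add, ← ha, neg_add_cancel, Real.exp_zero]
  change _ ≤ (1 : ℝ)
  linarith

end Increment

/-! ### Tail bound for a fixed pair and union bound over a finite set. -/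

section Concentration

variable {Ω : Type*} {mΩ : MeasurableSpace Ω} {μ : Measure Ω} [IsProbabilityMeasure μ]
  {ℱ : Filtration ℕ mΩ} {d T : ℕ} {φ : ℕ → Ω → EuclideanSpace ℝ (Fin d)} {y η σ : ℕ → Ω → ℝ}
  {θ : EuclideanSpace ℝ (Fin d)} {σmin βη : ℝ}

theorem abs_inner_le_of_norm_le_one {E : Type*} [NormedAddCommGroup E] [InnerProductSpace ℝ E]
    {u : E} (hu : ‖u‖ ≤ 1) (v : E) : |inner ℝ u v| ≤ ‖v‖ :=
  (abs_real_inner_le_norm u v).trans (mul_le_of_le_one_left (norm_nonneg v) hu)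

omit [IsProbabilityMeasure μ] in
theorem BoundedHeteroscedasticRegression.ae_abs_target_le
    (h : BoundedHeteroscedasticRegression μ ℱ T φ y η σ θ σmin βη) {t : ℕ}
    (ht : t ∈ Finset.Icc 1 T) : ∀ᵐ ω ∂μ, |y t ω| ≤ ‖θ‖ + βη := by
  filter_upwards [h.feature_le_one t ht, h.target_eq t ht, h.noise_bound t ht] with ω h1 h2 h3
  rw [h2]
  exact (abs_add_le _ _).trans (add_le_add (abs_inner_le_of_norm_le_one h1 θ) h3)

theorem BoundedHeteroscedasticRegression.condExp_target
    (h : BoundedHeteroscedasticRegression μ ℱ T φ y η σ θ σmin βη) {t : ℕ}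
    (ht : t ∈ Finset.Icc 1 T) :
    μ[y t | ℱ (t - 1)] =ᵐ[μ] fun ω => inner ℝ (φ t ω) θ := by
  have hφm := h.measurable_feature t ht
  have hm : Measurable[ℱ (t - 1)] fun ω => inner ℝ (φ t ω) θ :=
    (continuous_id.inner continuous_const).measurable.comp hφm
  have hi : Integrable (fun ω => inner ℝ (φ t ω) θ) μ :=
    Integrable.of_bound (hm.mono (ℱ.le _) le_rfl).aestronglyMeasurable ‖θ‖
      ((h.feature_le_one t ht).mono fun ω hω => abs_inner_le_of_norm_le_one hω θ)
  have hyi : Integrable (y t) μ :=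
    Integrable.of_bound ((h.measurable_target t ht).mono (ℱ.le _) le_rfl).aestronglyMeasurable _
      (h.ae_abs_target_le ht)
  have hη : η t =ᵐ[μ] y t - fun ω => inner ℝ (φ t ω) θ := by
    filter_upwards [h.target_eq t ht] with ω hω
    rw [Pi.sub_apply, hω, add_sub_cancel_left]
  filter_upwards [h.noise_mean t ht, condExp_congr_ae (m := ℱ (t - 1)) hη,
    condExp_sub hyi hi (ℱ (t - 1))] with ω h1 h2 h3
  rw [h2, h3, Pi.sub_apply, condExp_of_stronglyMeasurable (ℱ.le _) hm.stronglyMeasurable hi] at h1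
  exact sub_eq_zero.1 h1

theorem BoundedHeteroscedasticRegression.measure_le_catoniExcess_le
    (h : BoundedHeteroscedasticRegression μ ℱ T φ y η σ θ σmin βη) (hσ : 0 < σmin)
    (p : EuclideanSpace ℝ (Fin d)) (b u : ℝ) :
    μ {ω | u ≤ catoniExcess T (fun t => φ t ω) (fun t => y t ω) (fun t => σ t ω) θ p b} ≤
      ENNReal.ofReal (Real.exp (-u)) := by
  set g : ℕ → Ω → ℝ := fun t ω => Real.exp
    (catoniIncrement (inner ℝ p (φ t ω)) (σ t ω ^ 2)⁻¹ (y t ω) (inner ℝ (φ t ω) θ) b) with hg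
  have hx : ∀ t ∈ Finset.Icc 1 T, Measurable[ℱ (t - 1)] fun ω => inner ℝ p (φ t ω) := fun t ht =>
    (continuous_const.inner continuous_id).measurable.comp (h.measurable_feature t ht)
  have hν : ∀ t ∈ Finset.Icc 1 T, Measurable[ℱ (t - 1)] fun ω => inner ℝ (φ t ω) θ := fun t ht =>
    (continuous_id.inner continuous_const).measurable.comp (h.measurable_feature t ht)
  have hr : ∀ t ∈ Finset.Icc 1 T, Measurable[ℱ (t - 1)] fun ω => (σ t ω ^ 2)⁻¹ := fun t ht =>
    (h.measurable_variance t ht).inv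
  have hstep : ∀ t ∈ Finset.Icc 1 T, (∃ D, ∀ᵐ ω ∂μ, g t ω ≤ D) ∧ μ[g t | ℱ (t - 1)] ≤ᵐ[μ] 1 := by
    intro t ht
    have hβ : 0 ≤ βη := by
      obtain ⟨ω, hω⟩ := (h.noise_bound t ht).exists
      exact (abs_nonneg _).trans hω
    refine condExp_exp_catoniIncrement_le_one (A := ‖p‖) (R := (σmin ^ 2)⁻¹) (C := ‖θ‖ + βη)
      (ℱ.le _) (hx t ht) (hr t ht) (hν t ht) ((h.measurable_target t ht).mono (ℱ.le _) le_rfl)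
      ?_ ?_ ?_ (h.ae_abs_target_le ht) ?_ (h.condExp_target ht) ?_ b
    · filter_upwards [h.feature_le_one t ht] with ω hω
      rw [real_inner_comm]
      exact abs_inner_le_of_norm_le_one hω p
    · filter_upwards [h.variance_ge t ht] with ω hω
      exact inv_pos.2 ((by positivity : 0 < σmin ^ 2).trans_le hω)
    · filter_upwards [h.variance_ge t ht] with ω hω
      exact inv_anti₀ (by positivity) hω
    · filter_upwards [h.feature_le_one t ht] with ω hω
      exact (abs_inner_le_of_norm_le_one hω θ).trans (by linarith)
    · simpa only [inv_inv] using h.second_moment_le t ht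
  have hgm : ∀ t ∈ Finset.Icc 1 T, StronglyMeasurable[ℱ t] (g t) := by
    intro t ht
    have hle := ℱ.mono (Nat.sub_le t 1)
    have h1 := (hx t ht).mono hle le_rfl
    have h2 := (hν t ht).mono hle le_rfl
    have h3 := (hr t ht).mono hle le_rfl
    have h4 := h.measurable_target t ht
    have h5 := catoniPsi_continuous.measurable
    refine Measurable.stronglyMeasurable ?_
    simp only [hg]
    unfold catoniIncrement
    fun_prop
  obtain ⟨-, hint, hle⟩ := integrable_prod_and_integral_le_one T hgm
    (fun t _ ω => (Real.exp_pos _).le) (fun t ht => (hstep t ht).1) (fun t ht => (hstep t ht).2)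
  have hmk := mul_meas_ge_le_integral_of_nonneg (ae_of_all μ fun ω =>
    Finset.prod_nonneg fun t _ => (Real.exp_pos _).le) hint (Real.exp u)
  have hset : {ω | u ≤ catoniExcess T (fun t => φ t ω) (fun t => y t ω) (fun t => σ t ω) θ p b} =
      {ω | Real.exp u ≤ ∏ t ∈ Finset.Icc 1 T, g t ω} := by
    ext ω
    simp only [Set.mem_ofPred_eq, hg, ← Real.exp_sum, Real.exp_le_exp, catoniExcess]
  rw [hset, ← ofReal_measureReal]
  refine ENNReal.ofReal_le_ofReal ?_
  rw [Real.exp_neg, ← one_div, le_div_iff₀ (Real.exp_pos u), mul_comm]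
  exact hmk.trans hle

theorem BoundedHeteroscedasticRegression.exists_event
    (h : BoundedHeteroscedasticRegression μ ℱ T φ y η σ θ σmin βη) (hσ : 0 < σmin)
    {S : Finset (EuclideanSpace ℝ (Fin d) × ℝ)} (hS : S.Nonempty) {δ : ℝ} (hδ : 0 < δ) :
    ∃ E : Set Ω, MeasurableSet E ∧ ENNReal.ofReal (1 - δ) ≤ μ E ∧ ∀ ω ∈ E,
      (∀ t ∈ Finset.Icc 1 T, ‖φ t ω‖ ≤ 1 ∧ |y t ω| ≤ ‖θ‖ + βη ∧ σmin ^ 2 ≤ σ t ω ^ 2) ∧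
      ∀ s ∈ S, catoniExcess T (fun t => φ t ω) (fun t => y t ω) (fun t => σ t ω) θ s.1 s.2 ≤
        Real.log (S.card / δ) := by
  have hc : (0 : ℝ) < S.card := by exact_mod_cast hS.card_pos
  set N : Set Ω := {ω | ¬ ∀ t ∈ Finset.Icc 1 T,
    ‖φ t ω‖ ≤ 1 ∧ |y t ω| ≤ ‖θ‖ + βη ∧ σmin ^ 2 ≤ σ t ω ^ 2} with hN
  set F : EuclideanSpace ℝ (Fin d) × ℝ → Set Ω := fun s => {ω | Real.log (S.card / δ) ≤
    catoniExcess T (fun t => φ t ω) (fun t => y t ω) (fun t => σ t ω) θ s.1 s.2} with hF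
  have hN0 : μ N = 0 := by
    change ∀ᵐ ω ∂μ, ∀ t ∈ Finset.Icc 1 T,
      ‖φ t ω‖ ≤ 1 ∧ |y t ω| ≤ ‖θ‖ + βη ∧ σmin ^ 2 ≤ σ t ω ^ 2
    rw [Filter.eventually_all_finset]
    intro t ht
    filter_upwards [h.feature_le_one t ht, h.ae_abs_target_le ht, h.variance_ge t ht]
      with ω h1 h2 h3 using ⟨h1, h2, h3⟩
  have hFle : μ (⋃ s ∈ S, F s) ≤ ENNReal.ofReal δ := by
    refine (measure_biUnion_finset_le S F).trans ?_
    refine (Finset.sum_le_sum fun s _ => h.measure_le_catoniExcess_le hσ s.1 s.2 _).trans ?_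
    rw [Finset.sum_const, Real.exp_neg, Real.exp_log (by positivity), nsmul_eq_mul,
      ← ENNReal.ofReal_natCast, ← ENNReal.ofReal_mul hc.le]
    exact ENNReal.ofReal_le_ofReal (by rw [inv_div]; field_simp; rfl)
  -- The measurable hull has the same measure, so measurability of the bad set need not be checked.
  set Bad := toMeasurable μ (N ∪ ⋃ s ∈ S, F s) with hBad
  have hBle : μ Bad ≤ ENNReal.ofReal δ := by
    rw [hBad, measure_toMeasurable]
    refine (measure_union_le _ _).trans ?_
    rwa [hN0, zero_add]
  refine ⟨Badᶜ, (measurableSet_toMeasurable _ _).compl, ?_, fun ω hω => ?_⟩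
  · rw [prob_compl_eq_one_sub (measurableSet_toMeasurable _ _), ENNReal.ofReal_sub _ hδ.le,
      ENNReal.ofReal_one]
    exact tsub_le_tsub_left hBle 1
  · have hω' : ω ∉ N ∪ ⋃ s ∈ S, F s := fun hmem => hω (subset_toMeasurable _ _ hmem)
    simp only [Set.mem_union, Set.mem_iUnion, not_or, not_exists] at hω'
    refine ⟨not_not.1 hω'.1, fun s hs => ?_⟩
    exact (not_le.1 (hω'.2 s hs)).le

end Concentration

/-! ### Discretisation of the pairs (p, b). -/

section Net

theorem exists_int_abs_sub_le {x ε U : ℝ} (hε : 0 < ε) (hx : |x| / ε + 1 ≤ U) :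
    ∃ n ∈ Finset.Icc (-⌊U⌋) ⌊U⌋, |x - ε * n| ≤ ε := by
  have h1 := Int.floor_le (x / ε)
  have h2 := Int.lt_floor_add_one (x / ε)
  have h3 : |x / ε| = |x| / ε := by rw [abs_div, abs_of_pos hε]
  have h4 := neg_abs_le (x / ε)
  have h5 := le_abs_self (x / ε)
  have h6 : ε * (x / ε) = x := by field_simp
  refine ⟨⌊x / ε⌋, Finset.mem_Icc.2 ⟨?_, ?_⟩, ?_⟩
  · rw [neg_le, Int.le_floor]
    push_cast
    linarith
  · exact Int.floor_mono (by linarith)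
  · rw [abs_le]
    constructor <;> nlinarith

/-- A cubic grid of mesh Q⁻⁷, with at most 2Q⁹ + 1 ≤ Q¹⁰ values per coordinate, has logarithmic size
at most 10(d + 1) log Q ≤ 20 d log Q. The added 1 is room for the rounding error and is absorbed by
d log Q ≥ 1. -/
theorem exists_finset_net {d : ℕ} (hd : 1 ≤ d) {Q : ℝ} (hQ : 8 ≤ Q) :
    ∃ S : Finset (EuclideanSpace ℝ (Fin d) × ℝ), S.Nonempty ∧
      Real.log S.card + 1 ≤ 21 * d * Real.log Q ∧
      ∀ (p : EuclideanSpace ℝ (Fin d)) (b : ℝ), ‖p‖ ≤ Q → |b| ≤ Q + 1 →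
        ∃ s ∈ S, ‖p - s.1‖ ≤ d * (Q ^ 7)⁻¹ ∧ |b - s.2| ≤ (Q ^ 7)⁻¹ := by
  classical
  set ε := (Q ^ 7)⁻¹ with hε
  have hε0 : 0 < ε := by positivity
  set I := Finset.Icc (-⌊Q ^ 9⌋) ⌊Q ^ 9⌋ with hI
  have hpow : ∀ n : ℕ, Q ^ n * 8 ≤ Q ^ (n + 1) := fun n => by
    rw [pow_succ]; exact mul_le_mul_of_nonneg_left hQ (by positivity)
  have hU : ∀ x : ℝ, |x| ≤ Q + 1 → |x| / ε + 1 ≤ Q ^ 9 := fun x hx => by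
    have h1 : |x| / ε ≤ (Q + 1) * Q ^ 7 := by
      rw [hε, div_inv_eq_mul]; exact mul_le_mul_of_nonneg_right hx (by positivity)
    have h2 := hpow 7
    have h3 := hpow 8
    have h4 : 1 ≤ Q ^ 8 := one_le_pow₀ (by linarith)
    have h5 : (Q + 1) * Q ^ 7 = Q ^ 8 + Q ^ 7 := by ring
    norm_num at h2 h3
    linarith
  set f : (Fin d → ℤ) × ℤ → EuclideanSpace ℝ (Fin d) × ℝ :=
    fun z => (WithLp.toLp 2 fun i => ε * z.1 i, ε * z.2) with hf
  set G : Finset ((Fin d → ℤ) × ℤ) := (Fintype.piFinset fun _ => I) ×ˢ I with hG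
  have hnet : ∀ (p : EuclideanSpace ℝ (Fin d)) (b : ℝ), ‖p‖ ≤ Q → |b| ≤ Q + 1 →
      ∃ s ∈ G.image f, ‖p - s.1‖ ≤ d * ε ∧ |b - s.2| ≤ ε := by
    intro p b hp hb
    have hpi : ∀ i, ∃ n ∈ I, |p i - ε * n| ≤ ε := fun i =>
      exists_int_abs_sub_le hε0 (hU _ (((PiLp.norm_apply_le p i).trans hp).trans (by linarith)))
    choose n hn hpn using hpi
    obtain ⟨k, hk, hbk⟩ := exists_int_abs_sub_le hε0 (hU _ hb)
    refine ⟨f (n, k), Finset.mem_image_of_mem f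
      (Finset.mem_product.2 ⟨Fintype.mem_piFinset.2 hn, hk⟩), ?_, hbk⟩
    rw [EuclideanSpace.norm_eq, Real.sqrt_le_left (by positivity)]
    have h1 : ∀ i ∈ Finset.univ, ‖(p - (f (n, k)).1) i‖ ^ 2 ≤ ε ^ 2 := fun i _ =>
      pow_le_pow_left₀ (norm_nonneg _) (hpn i) 2
    refine (Finset.sum_le_card_nsmul _ _ _ h1).trans ?_
    rw [Finset.card_univ, Fintype.card_fin, nsmul_eq_mul, mul_pow]
    have : (1 : ℝ) ≤ d := by exact_mod_cast hd
    exact mul_le_mul_of_nonneg_right (by nlinarith) (by positivity)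
  have hne : (G.image f).Nonempty := by
    obtain ⟨s, hs, -⟩ := hnet 0 0 (by simp; linarith) (by simp; linarith)
    exact ⟨s, hs⟩
  refine ⟨G.image f, hne, ?_, hnet⟩
  have hIc : (I.card : ℝ) ≤ Q ^ 10 := by
    have h0 : (0 : ℤ) ≤ ⌊Q ^ 9⌋ := Int.floor_nonneg.2 (by positivity)
    have h1 : (I.card : ℤ) = ⌊Q ^ 9⌋ + 1 + ⌊Q ^ 9⌋ := by
      rw [hI, Int.card_Icc, Int.toNat_of_nonneg (by linarith)]; ring
    have h2 : (I.card : ℝ) = ⌊Q ^ 9⌋ + 1 + ⌊Q ^ 9⌋ := by exact_mod_cast h1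
    have h3 := Int.floor_le (Q ^ 9)
    have h4 := hpow 9
    have h5 : 1 ≤ Q ^ 9 := one_le_pow₀ (by linarith)
    norm_num at h4
    linarith
  have hcard : ((G.image f).card : ℝ) ≤ (Q ^ 10) ^ (d + 1) := by
    have h1 : (G.image f).card ≤ I.card ^ (d + 1) := by
      refine Finset.card_image_le.trans (le_of_eq ?_)
      rw [hG, Finset.card_product, Fintype.card_piFinset_const, pow_succ]
    calc ((G.image f).card : ℝ) ≤ (I.card : ℝ) ^ (d + 1) := by exact_mod_cast h1
      _ ≤ _ := by gcongr
  have hlogQ : 1 ≤ Real.log Q := by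
    rw [Real.le_log_iff_exp_le (by linarith)]
    linarith [Real.exp_one_lt_d9]
  have h1 := Real.log_le_log (by exact_mod_cast hne.card_pos) hcard
  rw [Real.log_pow, Real.log_pow] at h1
  push_cast at h1
  have hd' : (1 : ℝ) ≤ d := by exact_mod_cast hd
  nlinarith

theorem catoniExcess_le_add_one {d T : ℕ} {φ : ℕ → EuclideanSpace ℝ (Fin d)} {y σ : ℕ → ℝ}
    {θ p p' : EuclideanSpace ℝ (Fin d)} {b b' R C Q : ℝ}
    (hd : 1 ≤ d) (hdT : d ≤ T) (hTQ : T ≤ Q) (hQ : 8 ≤ Q) (hRQ : R ≤ Q) (hRCQ : R * C ≤ Q)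
    (hσ : ∀ t ∈ Finset.Icc 1 T, (σ t ^ 2)⁻¹ ≤ R) (hφ : ∀ t ∈ Finset.Icc 1 T, ‖φ t‖ ≤ 1)
    (hy : ∀ t ∈ Finset.Icc 1 T, |y t| ≤ C) (hθ : ‖θ‖ ≤ C)
    (hp : ‖p‖ ≤ Q) (hb : |b| ≤ Q + 1) (hpp : ‖p - p'‖ ≤ d * (Q ^ 7)⁻¹)
    (hbb : |b - b'| ≤ (Q ^ 7)⁻¹) :
    catoniExcess T φ y σ θ p b ≤ catoniExcess T φ y σ θ p' b' + 1 := by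
  have hd' : (1 : ℝ) ≤ d := by exact_mod_cast hd
  have hdT' : (d : ℝ) ≤ T := by exact_mod_cast hdT
  set ε := (d : ℝ) * (Q ^ 7)⁻¹ with hε
  have hQ0 : 0 < Q := by linarith
  have hεQ : (Q ^ 7)⁻¹ ≤ ε := le_mul_of_one_le_left (by positivity) hd'
  have hε0 : 0 ≤ ε := (norm_nonneg _).trans hpp
  -- Total rounding error: T steps, distance dQ⁻⁷, Lipschitz constant at most Q³. Since d ≤ T ≤ Q,
  -- the mesh exponent 7 is ample.
  have hTε : T * (ε * Q ^ 3) ≤ 1 := by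
    have h1 : (T : ℝ) * d * Q ^ 3 ≤ Q * Q * Q ^ 3 := by gcongr; exact hdT'.trans hTQ
    have h2 : Q * Q * Q ^ 3 ≤ Q ^ 7 := by
      rw [← sq, ← pow_add]; exact pow_le_pow_right₀ (by linarith) (by norm_num)
    calc T * (ε * Q ^ 3) = T * d * Q ^ 3 / Q ^ 7 := by rw [hε]; field_simp
      _ ≤ 1 := (div_le_one (by positivity)).2 (h1.trans h2)
  have hε1 : ε ≤ 1 := by
    have h1 : (1 : ℝ) ≤ T := hd'.trans hdT'
    have h2 : 1 ≤ Q ^ 3 := one_le_pow₀ (by linarith)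
    calc ε = 1 * (ε * 1) := by ring
      _ ≤ T * (ε * Q ^ 3) := by gcongr
      _ ≤ 1 := hTε
  have hp' : ‖p'‖ ≤ 2 * Q := by
    have := norm_le_norm_add_norm_sub p p'
    linarith
  have hb' : |b'| ≤ 2 * Q := by
    have h1 := abs_sub_abs_le_abs_sub b' b
    rw [abs_sub_comm] at h1
    linarith
  have hstep : ∀ t ∈ Finset.Icc 1 T,
      catoniIncrement (inner ℝ p (φ t)) (σ t ^ 2)⁻¹ (y t) (inner ℝ (φ t) θ) b ≤
      catoniIncrement (inner ℝ p' (φ t)) (σ t ^ 2)⁻¹ (y t) (inner ℝ (φ t) θ) b' + ε * Q ^ 3 := by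
    intro t ht
    have hin : ∀ q : EuclideanSpace ℝ (Fin d), |inner ℝ q (φ t)| ≤ ‖q‖ := fun q => by
      rw [real_inner_comm]; exact abs_inner_le_of_norm_le_one (hφ t ht) q
    have hxx : |(inner ℝ p (φ t) : ℝ) - inner ℝ p' (φ t)| ≤ ε := by
      rw [← inner_sub_left]; exact (hin _).trans hpp
    have h := abs_catoniIncrement_sub_le (A := 2 * Q) (B := 2 * Q)
      ((hin p).trans (by linarith)) ((hin p').trans hp')
      (inv_nonneg.2 (sq_nonneg (σ t))) (hσ t ht) (hy t ht)
      ((abs_inner_le_of_norm_le_one (hφ t ht) θ).trans hθ) (hb.trans (by linarith)) hb'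
      hxx (hbb.trans hεQ)
    -- The left side is at most 6Q² + 4Q + 2 ≤ 8Q², whence Q ≥ 8.
    have h2 : 2 * (R * C) + 2 + 2 * Q * R + 2 * Q * (R * C) + 2 * Q * (R * C) + 2 * Q ≤ Q ^ 3 := by
      have e1 : 2 * Q * R ≤ 2 * Q * Q := by gcongr
      have e2 : 2 * Q * (R * C) ≤ 2 * Q * Q := by gcongr
      nlinarith [mul_nonneg (sq_nonneg Q) (sub_nonneg.2 hQ)]
    have h3 := (le_abs_self _).trans (h.trans (mul_le_mul_of_nonneg_left h2 hε0))
    linarith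
  refine (Finset.sum_le_sum hstep).trans ?_
  rw [Finset.sum_add_distrib, Finset.sum_const, Nat.card_Icc, add_tsub_cancel_right, nsmul_eq_mul]
  exact add_le_add le_rfl hTε

end Net

/-! ### Linear algebra and the error bound on the good event. -/

section Deterministic

variable {d T : ℕ} {φ : ℕ → EuclideanSpace ℝ (Fin d)} {y σ : ℕ → ℝ}
  {θ : EuclideanSpace ℝ (Fin d)} {lam αmax L : ℝ}

theorem dotProduct_ofLp_eq_inner (u w : EuclideanSpace ℝ (Fin d)) :
    u.ofLp ⬝ᵥ w.ofLp = inner ℝ u w := by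
  rw [EuclideanSpace.inner_eq_star_dotProduct, star_trivial, dotProduct_comm]

theorem dotProduct_covSigma_mulVec (u w : EuclideanSpace ℝ (Fin d)) :
    u.ofLp ⬝ᵥ covSigma T φ σ *ᵥ w.ofLp =
      ∑ t ∈ Finset.Icc 1 T, (σ t ^ 2)⁻¹ * (inner ℝ u (φ t) * inner ℝ w (φ t)) := by
  unfold covSigma
  rw [Matrix.sum_mulVec, dotProduct_sum]
  refine Finset.sum_congr rfl fun t _ => ?_
  rw [Matrix.smul_mulVec, dotProduct_smul, Matrix.vecMulVec_mulVec, op_smul_eq_smul,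
    dotProduct_smul, smul_eq_mul, smul_eq_mul, dotProduct_ofLp_eq_inner, dotProduct_ofLp_eq_inner,
    real_inner_comm w (φ t)]
  ring

theorem covLambda_posDef (hlam : 0 < lam) : (covLambda T lam φ σ).PosDef := by
  refine (Matrix.PosDef.one.smul hlam).add_posSemidef (Matrix.posSemidef_sum _ fun t _ => ?_)
  refine Matrix.PosSemidef.smul ?_ (by positivity)
  simpa using Matrix.posSemidef_vecMulVec_self_star (φ t).ofLp

/-- The vector `Λ_T⁻¹ v`. -/
noncomputable def covSolve (T : ℕ) (lam : ℝ) (φ : ℕ → EuclideanSpace ℝ (Fin d)) (σ : ℕ → ℝ)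
    (v : EuclideanSpace ℝ (Fin d)) : EuclideanSpace ℝ (Fin d) :=
  WithLp.toLp 2 ((covLambda T lam φ σ)⁻¹ *ᵥ v.ofLp)

theorem dotProduct_covLambda_inv_mulVec (hlam : 0 < lam) (u v : EuclideanSpace ℝ (Fin d)) :
    v.ofLp ⬝ᵥ (covLambda T lam φ σ)⁻¹ *ᵥ u.ofLp = inner ℝ (covSolve T lam φ σ v) u := by
  have hs : ((covLambda T lam φ σ)⁻¹)ᵀ = (covLambda T lam φ σ)⁻¹ := by
    have := (covLambda_posDef (T := T) (φ := φ) (σ := σ) hlam).inv.isHermitian.eq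
    rwa [Matrix.conjTranspose_eq_transpose_of_trivial] at this
  rw [Matrix.dotProduct_mulVec, ← Matrix.mulVec_transpose, hs, ← dotProduct_ofLp_eq_inner]
  rfl

/-- Pairing Λ_T w = v with u. For u = θ this separates the ridge bias from the mean M; for u = w it
evaluates ‖v‖² in the Λ_T⁻¹ norm. -/
theorem inner_eq_covSolve (hlam : 0 < lam) (u v : EuclideanSpace ℝ (Fin d)) :
    inner ℝ v u = lam * inner ℝ (covSolve T lam φ σ v) u + ∑ t ∈ Finset.Icc 1 T,
      (σ t ^ 2)⁻¹ * (inner ℝ (covSolve T lam φ σ v) (φ t) * inner ℝ (φ t) u) := by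
  have hdet := (covLambda_posDef (T := T) (φ := φ) (σ := σ) hlam).isUnit
  rw [Matrix.isUnit_iff_isUnit_det] at hdet
  have hv : covLambda T lam φ σ *ᵥ (covSolve T lam φ σ v).ofLp = v.ofLp := by
    change covLambda T lam φ σ *ᵥ ((covLambda T lam φ σ)⁻¹ *ᵥ v.ofLp) = _
    rw [Matrix.mulVec_mulVec, Matrix.mul_nonsing_inv _ hdet, Matrix.one_mulVec]
  rw [real_inner_comm, ← dotProduct_ofLp_eq_inner, ← hv]
  unfold covLambda
  rw [Matrix.add_mulVec, dotProduct_add, dotProduct_covSigma_mulVec, Matrix.smul_mulVec,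
    Matrix.one_mulVec, dotProduct_smul, dotProduct_ofLp_eq_inner, smul_eq_mul,
    real_inner_comm (covSolve T lam φ σ v) u]
  congr 1
  refine Finset.sum_congr rfl fun t _ => ?_
  rw [real_inner_comm u (φ t)]
  ring

theorem inner_covSolve_self (hlam : 0 < lam) (v : EuclideanSpace ℝ (Fin d)) :
    inner ℝ v (covSolve T lam φ σ v) = lam * ‖covSolve T lam φ σ v‖ ^ 2 +
      ∑ t ∈ Finset.Icc 1 T, (σ t ^ 2)⁻¹ * (inner ℝ (covSolve T lam φ σ v) (φ t)) ^ 2 := by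
  rw [inner_eq_covSolve (T := T) (φ := φ) (σ := σ) hlam, real_inner_self_eq_norm_sq]
  congr 1
  refine Finset.sum_congr rfl fun t _ => ?_
  rw [real_inner_comm (covSolve T lam φ σ v) (φ t)]
  ring

theorem norm_covSolve_le (hlam : 0 < lam) (v : EuclideanSpace ℝ (Fin d)) :
    lam * ‖covSolve T lam φ σ v‖ ≤ ‖v‖ := by
  set w := covSolve T lam φ σ v with hw
  have h1 := inner_covSolve_self (T := T) (φ := φ) (σ := σ) hlam v
  have h2 : 0 ≤ ∑ t ∈ Finset.Icc 1 T, (σ t ^ 2)⁻¹ * (inner ℝ w (φ t)) ^ 2 :=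
    Finset.sum_nonneg fun t _ => by positivity
  have h3 := real_inner_le_norm v w
  rcases (norm_nonneg w).eq_or_lt with h0 | h0
  · rw [← h0, mul_zero]; exact norm_nonneg v
  · refine le_of_mul_le_mul_right ?_ h0
    rw [← hw] at h1
    nlinarith

theorem matNorm_covSigma_sq (a : ℝ) (w : EuclideanSpace ℝ (Fin d)) :
    matNorm (covSigma T φ σ) (a • w.ofLp) ^ 2 =
      a ^ 2 * ∑ t ∈ Finset.Icc 1 T, (σ t ^ 2)⁻¹ * (inner ℝ w (φ t)) ^ 2 := by
  have h : (a • w.ofLp) ⬝ᵥ covSigma T φ σ *ᵥ (a • w.ofLp) =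
      a ^ 2 * ∑ t ∈ Finset.Icc 1 T, (σ t ^ 2)⁻¹ * (inner ℝ w (φ t)) ^ 2 := by
    rw [Matrix.mulVec_smul, dotProduct_smul, smul_dotProduct, dotProduct_covSigma_mulVec,
      smul_eq_mul, smul_eq_mul, ← mul_assoc, ← sq]
    simp only [sq]
  unfold matNorm
  rw [h, Real.sq_sqrt]
  exact mul_nonneg (sq_nonneg a) (Finset.sum_nonneg fun t _ => by positivity)

/-- The third claim keeps the second-moment term below L; the fourth controls the width. When the
minimum is √L/N, L/α is exactly √L N; otherwise it is L/αmax. -/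
theorem catoniParam_spec (hα : 0 < αmax) (hL : 0 < L) (v : EuclideanSpace ℝ (Fin d)) :
    let N := matNorm (covSigma T φ σ) ((T : ℝ) • ((covLambda T lam φ σ)⁻¹ *ᵥ v.ofLp))
    let α := catoniParam T lam αmax L φ σ v
    0 < α ∧ α ≤ αmax ∧ α ^ 2 * N ^ 2 ≤ L ∧ L / α ≤ √L * N + L / αmax := by
  intro N α
  have hN0 : 0 ≤ N := Real.sqrt_nonneg _
  have hαdef : α = if N = 0 then αmax else min (√((N ^ 2)⁻¹ * L)) αmax := rfl
  rcases hN0.eq_or_lt with h0 | h0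
  · rw [if_pos h0.symm] at hαdef
    rw [hαdef, ← h0]
    simp [hα, hL.le]
  · rw [if_neg h0.ne'] at hαdef
    have hsq : √((N ^ 2)⁻¹ * L) = √L / N := by
      rw [Real.sqrt_mul (by positivity), Real.sqrt_inv, Real.sqrt_sq hN0]; field_simp
    rw [hsq] at hαdef
    have hpos : 0 < √L / N := by positivity
    have hα0 : 0 < α := by rw [hαdef]; exact lt_min hpos hα
    refine ⟨hα0, hαdef ▸ min_le_right _ _, ?_, ?_⟩
    · have h1 : α ≤ √L / N := hαdef ▸ min_le_left _ _
      rw [le_div_iff₀ h0] at h1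
      rw [← mul_pow]
      calc (α * N) ^ 2 ≤ √L ^ 2 := by gcongr
        _ = L := Real.sq_sqrt hL.le
    · rcases min_choice (√L / N) αmax with h | h
      · rw [hαdef, h]
        have h2 : L / (√L / N) = √L * N := by
          rw [div_div_eq_mul_div, div_eq_iff (by positivity)]
          nth_rewrite 1 [← Real.mul_self_sqrt hL.le]
          ring
        rw [h2]
        have : 0 < L / αmax := by positivity
        linarith
      · rw [hαdef, h]
        have : 0 ≤ √L * N := by positivity
        linarith

theorem catoni_le_of_catoniExcess_le (hT : 1 ≤ T) (hL : 0 < L) (hLT : 5 * L ≤ T) {α : ℝ}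
    (hα : 0 < α) (w : EuclideanSpace ℝ (Fin d))
    (hs : α ^ 2 * (T ^ 2 * ∑ t ∈ Finset.Icc 1 T, (σ t ^ 2)⁻¹ * (inner ℝ w (φ t)) ^ 2) ≤ L)
    (h : catoniExcess T φ y σ θ ((α * T) • w)
      (α * ∑ t ∈ Finset.Icc 1 T, (σ t ^ 2)⁻¹ * (inner ℝ w (φ t) * inner ℝ (φ t) θ) + 3 * L / T)
        ≤ L) :
    catoni T (fun t => T * inner ℝ w (φ t) * y t / σ t ^ 2) α ≤
      ∑ t ∈ Finset.Icc 1 T, (σ t ^ 2)⁻¹ * (inner ℝ w (φ t) * inner ℝ (φ t) θ)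
        + 3 * L / (α * T) := by
  refine catoni_le_of_sum_le hT
    (m := fun t => T * ((σ t ^ 2)⁻¹ * (inner ℝ w (φ t) * inner ℝ (φ t) θ)))
    (s := fun t => T ^ 2 * ((σ t ^ 2)⁻¹ * (inner ℝ w (φ t)) ^ 2)) hα hL hLT ?_ ?_ ?_
  · rw [← Finset.mul_sum]
  · rwa [← Finset.mul_sum]
  · refine le_trans (le_of_eq ?_) h
    unfold catoniExcess
    refine Finset.sum_congr rfl fun t _ => ?_
    unfold catoniIncrement
    rw [real_inner_smul_left]
    congr 1
    · congr 1
      ring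
    · ring

theorem abs_catoniDirectional_sub_le {σmin : ℝ} (hT : 1 ≤ T) (hlam : 0 < lam) (hαmax : 0 < αmax)
    (hσmin : 0 < σmin) (hL : 0 < L) (hLT : 5 * L ≤ T)
    (hφ : ∀ t ∈ Finset.Icc 1 T, ‖φ t‖ ≤ 1) (hσ : ∀ t ∈ Finset.Icc 1 T, σmin ^ 2 ≤ σ t ^ 2)
    (hgood : ∀ (p : EuclideanSpace ℝ (Fin d)) (b : ℝ), ‖p‖ ≤ αmax * T * lam⁻¹ →
      |b| ≤ αmax * T * lam⁻¹ * (σmin ^ 2)⁻¹ * ‖θ‖ + 1 → catoniExcess T φ y σ θ p b ≤ L)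
    {v : EuclideanSpace ℝ (Fin d)} (hv : ‖v‖ ≤ 1) :
    |catoniDirectional T lam αmax L φ y σ v - inner ℝ v θ| ≤
      5 * matNorm (covLambda T lam φ σ)⁻¹ v.ofLp * (√L + √lam * ‖θ‖) + 3 * L / (αmax * T) := by
  have hT0 : (0 : ℝ) < T := by exact_mod_cast hT
  obtain ⟨hα, hαle, hαN, hLα⟩ := catoniParam_spec (T := T) (φ := φ) (σ := σ) (lam := lam) hαmax hL v
  set w := covSolve T lam φ σ v with hw
  change _ * matNorm (covSigma T φ σ) ((T : ℝ) • w.ofLp) ^ 2 ≤ _ at hαN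
  change _ ≤ _ * matNorm (covSigma T φ σ) ((T : ℝ) • w.ofLp) + _ at hLα
  set α := catoniParam T lam αmax L φ σ v with hαdef
  set N := matNorm (covSigma T φ σ) ((T : ℝ) • w.ofLp) with hN
  have hNsq : N ^ 2 = _ := matNorm_covSigma_sq (T : ℝ) w
  rw [hNsq] at hαN
  set S := ∑ t ∈ Finset.Icc 1 T, (σ t ^ 2)⁻¹ * (inner ℝ w (φ t)) ^ 2 with hS
  set M := ∑ t ∈ Finset.Icc 1 T, (σ t ^ 2)⁻¹ * (inner ℝ w (φ t) * inner ℝ (φ t) θ) with hM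
  set V := matNorm (covLambda T lam φ σ)⁻¹ v.ofLp with hV
  have hS0 : 0 ≤ S := Finset.sum_nonneg fun t _ => by positivity
  have hwv := inner_covSolve_self (T := T) (φ := φ) (σ := σ) hlam v
  rw [← hw, ← hS] at hwv
  have hV0 : 0 ≤ V := Real.sqrt_nonneg _
  have hVsq : V ^ 2 = lam * ‖w‖ ^ 2 + S := by
    rw [hV, matNorm, dotProduct_covLambda_inv_mulVec hlam, ← hw, real_inner_comm, hwv,
      Real.sq_sqrt (by positivity)]
  have hNV : N ≤ T * V := by
    refine abs_le_of_sq_le_sq' ?_ (by positivity) |>.2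
    rw [hNsq, mul_pow, hVsq]
    exact mul_le_mul_of_nonneg_left (by nlinarith [mul_nonneg hlam.le (sq_nonneg ‖w‖)])
      (by positivity)
  have hlw : √lam * ‖w‖ ≤ V := by
    refine abs_le_of_sq_le_sq' ?_ hV0 |>.2
    rw [mul_pow, Real.sq_sqrt hlam.le, hVsq]
    linarith
  have hwn : ‖w‖ ≤ lam⁻¹ := by
    rw [← one_div, le_div_iff₀ hlam, mul_comm]
    exact (norm_covSolve_le hlam v).trans hv
  have hMabs : |M| ≤ T * (lam⁻¹ * (σmin ^ 2)⁻¹ * ‖θ‖) := by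
    refine (Finset.abs_sum_le_sum_abs _ _).trans ?_
    have : ∀ t ∈ Finset.Icc 1 T, |(σ t ^ 2)⁻¹ * ((inner ℝ w (φ t) : ℝ) * inner ℝ (φ t) θ)| ≤
        lam⁻¹ * (σmin ^ 2)⁻¹ * ‖θ‖ := by
      intro t ht
      rw [abs_mul, abs_mul, abs_of_nonneg (inv_nonneg.2 (sq_nonneg (σ t)))]
      have h1 : (σ t ^ 2)⁻¹ ≤ (σmin ^ 2)⁻¹ := inv_anti₀ (by positivity) (hσ t ht)
      have h2 : |(inner ℝ w (φ t) : ℝ)| ≤ lam⁻¹ := by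
        rw [real_inner_comm]; exact (abs_inner_le_of_norm_le_one (hφ t ht) w).trans hwn
      have h3 := abs_inner_le_of_norm_le_one (hφ t ht) θ
      calc _ ≤ (σmin ^ 2)⁻¹ * (lam⁻¹ * ‖θ‖) := by gcongr
        _ = _ := by ring
    refine (Finset.sum_le_card_nsmul _ _ _ this).trans (le_of_eq ?_)
    rw [Nat.card_Icc, add_tsub_cancel_right, nsmul_eq_mul]
  have hp : ‖(α * T) • w‖ ≤ αmax * T * lam⁻¹ := by
    rw [norm_smul, Real.norm_of_nonneg (by positivity)]
    gcongr
  have h3L : 3 * L / T ≤ 1 := by rw [div_le_one hT0]; linarith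
  have h3L0 : 0 ≤ 3 * L / T := by positivity
  -- Stated for both signs: the lower bound uses -w, whose mean is -M, while the shift 3L/T keeps
  -- its sign.
  have hb : ∀ M' : ℝ, |M'| = |M| →
      |α * M' + 3 * L / T| ≤ αmax * T * lam⁻¹ * (σmin ^ 2)⁻¹ * ‖θ‖ + 1 := by
    intro M' hM'
    refine (abs_add_le _ _).trans (add_le_add ?_ (by rwa [abs_of_nonneg h3L0]))
    rw [abs_mul, abs_of_pos hα, hM']
    calc α * |M| ≤ αmax * (T * (lam⁻¹ * (σmin ^ 2)⁻¹ * ‖θ‖)) := by gcongr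
      _ = _ := by ring
  have hcat : catoniDirectional T lam αmax L φ y σ v =
      catoni T (fun t => T * inner ℝ w (φ t) * y t / σ t ^ 2) α := by
    unfold catoniDirectional
    simp only [dotProduct_covLambda_inv_mulVec hlam, ← hw, ← hαdef]
  have hup := catoni_le_of_catoniExcess_le (y := y) (θ := θ) hT hL hLT hα w hαN
    (hgood _ _ hp (hb M rfl))
  have hlo := catoni_le_of_catoniExcess_le (y := y) (θ := θ) (φ := φ) (σ := σ) hT hL hLT hα (-w)
    (by simpa only [inner_neg_left, neg_sq] using hαN)
    (hgood _ _ (by rwa [smul_neg, norm_neg]) (hb _ (by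
      simp only [inner_neg_left, neg_mul, mul_neg, Finset.sum_neg_distrib, abs_neg, hM])))
  simp only [inner_neg_left, neg_mul, mul_neg, Finset.sum_neg_distrib, neg_div] at hlo
  rw [catoni_neg hT _ hα] at hlo
  rw [← hM] at hup hlo
  have hbias : inner ℝ v θ = lam * inner ℝ w θ + M := inner_eq_covSolve hlam θ v
  have hbias' : |lam * inner ℝ w θ| ≤ √lam * V * ‖θ‖ := by
    rw [abs_mul, abs_of_pos hlam]
    calc lam * |(inner ℝ w θ : ℝ)| ≤ lam * (‖w‖ * ‖θ‖) := by
          gcongr; exact abs_real_inner_le_norm w θ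
      _ = √lam * (√lam * ‖w‖) * ‖θ‖ := by
          nth_rewrite 1 [← Real.mul_self_sqrt hlam.le]; ring
      _ ≤ _ := by gcongr
  -- Here N ≤ TV, because Σ_T is dominated by Λ_T; the factor T cancels that of the denominator.
  have hwidth : 3 * L / (α * T) ≤ 3 * (V * √L) + 3 * L / (αmax * T) := by
    have e1 : 3 * L / (α * T) = 3 / T * (L / α) := by field_simp
    have e2 : 3 * L / (αmax * T) = 3 / T * (L / αmax) := by field_simp
    have e3 : 3 / T * (√L * (T * V)) = 3 * (V * √L) := by field_simp
    rw [e1, e2, ← e3, ← mul_add]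
    refine mul_le_mul_of_nonneg_left (hLα.trans ?_) (by positivity)
    gcongr
  have hVL : 0 ≤ V * √L := by positivity
  have hVθ : 0 ≤ √lam * V * ‖θ‖ := by positivity
  rw [hcat, hbias]
  have hfin : 5 * V * (√L + √lam * ‖θ‖) = 5 * (V * √L) + 5 * (√lam * V * ‖θ‖) := by ring
  rw [hfin]
  rw [abs_le] at hbias' ⊢
  constructor <;> linarith [hbias'.1, hbias'.2]

end Deterministic

/-! ### The scale Q and the final assembly. -/

/-- Q is the product of the six factors e + x. Each factor exceeds 1, so a product bounded factor by
factor is at most Q. The entry a² still dominates a, as a ≤ e + a². -/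
theorem exists_log_eq_logs {τ a l s β n : ℝ} (hτ : 0 ≤ τ) (ha : 0 ≤ a) (hl : 0 ≤ l) (hs : 0 ≤ s)
    (hβ : 0 ≤ β) (hn : 0 ≤ n) :
    ∃ Q : ℝ, Real.log Q = logs [τ, a ^ 2, l, s, β, n] ∧ 8 ≤ Q ∧ τ ≤ Q ∧ s ≤ Q ∧
      s * (n + β) ≤ Q ∧ a * τ * l ≤ Q ∧ a * τ * l * s * n ≤ Q := by
  have he : (2 : ℝ) ≤ Real.exp 1 := by linarith [Real.exp_one_gt_d9]
  set e := Real.exp 1 with hedef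
  have mono6 : ∀ a₁ a₂ a₃ a₄ a₅ a₆ : ℝ, 0 ≤ a₁ → 0 ≤ a₂ → 0 ≤ a₃ → 0 ≤ a₄ → 0 ≤ a₅ → 0 ≤ a₆ →
      a₁ ≤ e + τ → a₂ ≤ e + a ^ 2 → a₃ ≤ e + l → a₄ ≤ e + s → a₅ ≤ e + β → a₆ ≤ e + n →
      a₁ * a₂ * a₃ * a₄ * a₅ * a₆ ≤
        (e + τ) * (e + a ^ 2) * (e + l) * (e + s) * (e + β) * (e + n) := by
    intro a₁ a₂ a₃ a₄ a₅ a₆ _ _ _ _ _ _ _ _ _ _ _ _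
    gcongr
  have two : ∀ {x : ℝ}, 0 ≤ x → 2 ≤ e + x := fun hx => by linarith
  have one : ∀ {x : ℝ}, 0 ≤ x → 1 ≤ e + x := fun hx => by linarith
  have self : ∀ {x : ℝ}, x ≤ e + x := by intro x; linarith
  have ha2 := sq_nonneg a
  have haa : a ≤ e + a ^ 2 := by nlinarith [sq_nonneg (a - 1)]
  have h1 : (0 : ℝ) ≤ 1 := zero_le_one
  have h2 : (0 : ℝ) ≤ 2 := zero_le_two
  refine ⟨(e + τ) * (e + a ^ 2) * (e + l) * (e + s) * (e + β) * (e + n), ?_, ?_, ?_, ?_, ?_, ?_, ?_⟩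
  · simp only [logs, List.map_cons, List.map_nil, List.sum_cons, List.sum_nil, ← hedef]
    rw [Real.log_mul (by positivity) (by positivity), Real.log_mul (by positivity) (by positivity),
      Real.log_mul (by positivity) (by positivity), Real.log_mul (by positivity) (by positivity),
      Real.log_mul (by positivity) (by positivity)]
    ring
  · exact le_trans (by norm_num) (mono6 2 2 2 2 2 2 h2 h2 h2 h2 h2 h2 (two hτ) (two ha2) (two hl)
      (two hs) (two hβ) (two hn))
  · exact le_trans (le_of_eq (by ring)) (mono6 τ 1 1 1 1 1 hτ h1 h1 h1 h1 h1 self (one ha2)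
      (one hl) (one hs) (one hβ) (one hn))
  · exact le_trans (le_of_eq (by ring)) (mono6 1 1 1 s 1 1 h1 h1 h1 hs h1 h1 (one hτ) (one ha2)
      (one hl) self (one hβ) (one hn))
  · have h3 : n + β ≤ (e + β) * (e + n) := by nlinarith [mul_nonneg hβ hn]
    refine (mul_le_mul_of_nonneg_left h3 hs).trans ?_
    exact le_trans (le_of_eq (by ring)) (mono6 1 1 1 s (e + β) (e + n) h1 h1 h1 hs (by positivity)
      (by positivity) (one hτ) (one ha2) (one hl) self le_rfl le_rfl)
  · exact le_trans (le_of_eq (by ring)) (mono6 τ a l 1 1 1 hτ ha hl h1 h1 h1 self haa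
      self (one hs) (one hβ) (one hn))
  · exact le_trans (le_of_eq (by ring)) (mono6 τ a l s 1 n hτ ha hl hs h1 hn self haa
      self self (one hβ) self)

theorem mainTheorem5 :
    ∃ c : ℝ, 0 < c ∧
      ∀ (Ω : Type*) (mΩ : MeasurableSpace Ω) (μ : Measure Ω) (_ : IsProbabilityMeasure μ)
        (ℱ : Filtration ℕ mΩ) (d T : ℕ) (φ : ℕ → Ω → EuclideanSpace ℝ (Fin d))
        (y η σ : ℕ → Ω → ℝ) (θ : EuclideanSpace ℝ (Fin d)) (σmin βη lam αmax δ : ℝ),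
        0 < σmin → 0 ≤ βη → 0 < lam → 0 < αmax → 0 < δ → δ < 1 →
        BoundedHeteroscedasticRegression μ ℱ T φ y η σ θ σmin βη →
        5 * (Real.log (1 / δ) + effDim c d T αmax lam σmin βη ‖θ‖) ≤ (T : ℝ) →
        ∃ E : Set Ω, MeasurableSet E ∧ ENNReal.ofReal (1 - δ) ≤ μ E ∧
          ∀ ω ∈ E, ∀ v : EuclideanSpace ℝ (Fin d), ‖v‖ ≤ 1 →
            |catoniDirectional T lam αmax
                  (effDim c d T αmax lam σmin βη ‖θ‖ + Real.log (1 / δ))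
                  (fun t => φ t ω) (fun t => y t ω) (fun t => σ t ω) v - inner ℝ v θ| ≤
              5 * matNorm (covLambda T lam (fun t => φ t ω) (fun t => σ t ω))⁻¹ v.ofLp *
                  (√(Real.log (1 / δ) + effDim c d T αmax lam σmin βη ‖θ‖) + √lam * ‖θ‖) +
                3 * (Real.log (1 / δ) + effDim c d T αmax lam σmin βη ‖θ‖) / (αmax * T) := by
  -- The constant of `exists_finset_net`: 20 for the net size and 1 for the rounding error.
  refine ⟨21, by norm_num, ?_⟩
  intro Ω mΩ μ _ ℱ d T φ y η σ θ σmin βη lam αmax δ hσ hβ hlam hα hδ hδ1 h hT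
  have hlog : 0 < Real.log (1 / δ) := Real.log_pos (by rw [lt_div_iff₀ hδ]; linarith)
  set D := effDim 21 d T αmax lam σmin βη ‖θ‖ with hD
  rw [add_comm D]
  set L := Real.log (1 / δ) + D with hL
  obtain ⟨Q, hQlogs, hQ8, hTQ, hRQ, hRCQ, hpQ, hbQ⟩ := exists_log_eq_logs (τ := T) (a := αmax)
    (l := lam⁻¹) (s := (σmin ^ 2)⁻¹) (β := βη) (n := ‖θ‖) T.cast_nonneg hα.le
    (inv_nonneg.2 hlam.le) (by positivity) hβ (norm_nonneg θ)
  have hDQ : D = 21 * d * Real.log Q := by rw [hD, effDim, hQlogs]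
  have hlogQ : 1 ≤ Real.log Q := by
    rw [Real.le_log_iff_exp_le (by linarith)]
    linarith [Real.exp_one_lt_d9]
  have hD0 : 0 ≤ D := by rw [hDQ]; positivity
  have hL0 : 0 < L := by linarith
  have hT1 : 1 ≤ T := by
    have : (0 : ℝ) < T := by linarith
    exact_mod_cast this
  -- In dimension 0, d_T = 0 leaves no room for the rounding error; but all X_t vanish and the
  -- estimate is exactly 0.
  rcases Nat.eq_zero_or_pos d with hd | hd
  · subst hd
    refine ⟨Set.univ, MeasurableSet.univ, ?_, ?_⟩
    · rw [measure_univ, ← ENNReal.ofReal_one]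
      exact ENNReal.ofReal_le_ofReal (by linarith)
    · intro ω _ v _
      have hpar := (catoniParam_spec (T := T) (φ := fun t => φ t ω) (σ := fun t => σ t ω)
        (lam := lam) hα hL0 v).1
      have h0 : catoniDirectional T lam αmax L (fun t => φ t ω) (fun t => y t ω)
          (fun t => σ t ω) v = 0 := by
        unfold catoniDirectional
        rw [catoni_eq_iff hT1 _ hpar]
        simp [catoniFun, catoniPsi]
      rw [h0, Subsingleton.elim v 0, inner_zero_left, sub_zero, abs_zero]
      unfold matNorm
      positivity
  have hd' : (1 : ℝ) ≤ d := by exact_mod_cast hd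
  -- From T ≥ 5L ≥ 5·21·d log Q and log Q ≥ 1.
  have hdT : d ≤ T := by
    have h1 : (d : ℝ) ≤ T := by nlinarith
    exact_mod_cast h1
  obtain ⟨S, hSne, hScard, hSnet⟩ := exists_finset_net hd hQ8
  obtain ⟨E, hE, hμE, hEgood⟩ := h.exists_event hσ hSne hδ
  refine ⟨E, hE, hμE, fun ω hω v hv => ?_⟩
  obtain ⟨hreg, hex⟩ := hEgood ω hω
  refine abs_catoniDirectional_sub_le hT1 hlam hα hσ hL0 hT (fun t ht => (hreg t ht).1)
    (fun t ht => (hreg t ht).2.2) (fun p b hp hb => ?_) hv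
  have hpQ' := hp.trans hpQ
  have hbQ' : |b| ≤ Q + 1 := hb.trans (by linarith)
  obtain ⟨s, hsS, hps, hbs⟩ := hSnet p b hpQ' hbQ'
  have h1 := catoniExcess_le_add_one (y := fun t => y t ω) (σ := fun t => σ t ω)
    (φ := fun t => φ t ω) (θ := θ) hd hdT hTQ hQ8 hRQ hRCQ
    (fun t ht => inv_anti₀ (by positivity) (hreg t ht).2.2) (fun t ht => (hreg t ht).1)
    (fun t ht => (hreg t ht).2.1) (by linarith) hpQ' hbQ' hps hbs
  have h2 := hex s hsS
  have hc : (0 : ℝ) < S.card := by exact_mod_cast hSne.card_pos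
  have h3 : Real.log (S.card / δ) = Real.log S.card + Real.log (1 / δ) := by
    rw [← Real.log_mul hc.ne' (by positivity), mul_one_div]
  linarith
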